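/- Let $k\ge 1$, let $n_1,\dots,n_k\ge 2$ be integers, write $\mathbf n=(n_1,\dots,n_k)$, and let $\mathcal H$ be a complex Hilbert space. For a tuple $\mathbf T=(T_1,\dots,T_k)$ of rows $T_i=(T_{i,1},\dots,T_{i,n_i})$ of bounded operators on $\mathcal H$ put $\Phi_{T_i}(Y)=\sum_{j=1}^{n_i}T_{i,j}YT_{i,j}^*$ for $Y\in B(\mathcal H)$. The regular polyball $\mathbf B_{\mathbf n}(\mathcal H)$ is the set of those $\mathbf T$ for which $T_{s,a}$ and $T_{t,b}$ commute whenever $s\ne t$, and $(\mathrm{id}-\Phi_{T_1})^{p_1}\circ\cdots\circ(\mathrm{id}-\Phi_{T_k})^{p_k}(I)\ge 0$ for all $p_1,\dots,p_k\in\{0,1\}$. The defect operator of $\mathbf T$ is $\Delta_{\mathbf T}(I)=(\mathrm{id}-\Phi_{T_1})\circ\cdots\circ(\mathrm{id}-\Phi_{T_k})(I)$. Let $\mathbb F_{n_i}^+$ be the free monoid on $n_i$ generators $g^i_1,\dots,g^i_{n_i}$, with word length $|\cdot|$. For $\alpha=g^i_{j_1}\cdots g^i_{j_p}\in\mathbb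 F_{n_i}^+$ put $T_{i,\alpha}=T_{i,j_1}\cdots T_{i,j_p}$, with $T_{i,\alpha}=I$ for the empty word. Let $F^2(H_{n_i})$ be the full Fock space of an $n_i$-dimensional complex Hilbert space $H_{n_i}$, with its orthonormal basis $\{e^i_\alpha\}_{\alpha\in\mathbb F_{n_i}^+}$, and let $P^{(i)}_{q}$ be the orthogonal projection of $F^2(H_{n_i})$ onto the span of the $e^i_\alpha$ with $|\alpha|=q$. For $\mathbf T\in\mathbf B_{\mathbf n}(\mathcal H)$ the Berezin kernel is the contraction $$\mathbf K_{\mathbf T}:\mathcal H\to F^2(H_{n_1})\otimes\cdots\otimes F^2(H_{n_k})\otimes\overline{\Delta_{\mathbf T}(I)\mathcal H},\qquad \mathbf K_{\mathbf T}h=\sum_{\beta_1,\dots,\beta_k}e^1_{\beta_1}\otimes\cdots\otimes e^k_{\beta_k}\otimes\Delta_{\mathbf T}(I)^{1/2}T_{1,\beta_1}^*\cdots T_{k,\beta_k}^*h,$$ where $\beta_i$ runs over $\mathbb F_{n_i}^+$. The curvature of $\mathbf T$ is $$\operatorname{curv}(\mathbf T)=\lim_{m\to\infty}\frac1{\binom{m+k}{k}}\sum_{\substack{q_1,\dots,q_k\ge0\\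 q_1+\cdots+q_k\le m}}\frac{\operatorname{trace}\big[\mathbf K_{\mathbf T}^*(P^{(1)}_{q_1}\otimes\cdots\otimes P^{(k)}_{q_k}\otimes I)\mathbf K_{\mathbf T}\big]}{\operatorname{trace}\big[P^{(1)}_{q_1}\otimes\cdots\otimes P^{(k)}_{q_k}\big]}.$$ For $\mathbf q\in\mathbb Z_+^k$ let $M_{\mathbf q}(\mathbf T)$ be the linear span of all $T_{1,\alpha_1}\cdots T_{k,\alpha_k}h$ with $\alpha_i\in\mathbb F_{n_i}^+$, $|\alpha_i|\le q_i$ and $h\in\Delta_{\mathbf T}(I)\mathcal H$. The Euler characteristic of $\mathbf T$ is $$\chi(\mathbf T)=\lim_{m\to\infty}\frac{\dim M_{\mathbf q^{(m)}}(\mathbf T)}{\prod_{i=1}^k\big(1+n_i+\cdots+n_i^{q_i^{(m)}}\big)},$$ where $(\mathbf q^{(m)})_{m}$ is any increasing cofinal sequence in $\mathbb Z_+^k$ with the coordinatewise order. If $\mathbf T\in\mathbf B_{\mathbf n}(\mathcal H)$ has finite rank defect, that is, if $\Delta_{\mathbf T}(I)$ has finite rank, then the limit defining $\operatorname{curv}(\mathbf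 T)$ exists, the limit defining $\chi(\mathbf T)$ exists and is the same for every increasing cofinal sequence, and $$0\le\operatorname{curv}(\mathbf T)\le\chi(\mathbf T)\le\operatorname{rank}\,[\Delta_{\mathbf T}(I)].$$ -/

import Mathlib

open Filter Topology
open scoped ENNReal InnerProductSpace

noncomputable section

namespace NCPolyball

/-! ### Tuples of operators, defect maps, the regular polyball -/

/-- A `k`-tuple `X = (X₁, …, X_k)` whose `i`-th entry is a row `(X_{i,1}, …, X_{i,n_i})` of bounded
operators on `H`. -/
abbrev OpTuple {k : ℕ} (n : Fin k → ℕ) (H : Type*) [NormedAddCommGroup H]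
    [InnerProductSpace ℂ H] : Type _ :=
  (i : Fin k) → Fin (n i) → (H →L[ℂ] H)

/-- The free semigroup elements `(α₁, …, α_k)`, one word `α_i` in `n_i` letters for each `i`. -/
abbrev Words {k : ℕ} (n : Fin k → ℕ) : Type :=
  (i : Fin k) → FreeMonoid (Fin (n i))

section Operators

variable {H : Type*} [NormedAddCommGroup H] [InnerProductSpace ℂ H] [CompleteSpace H]

/-- The completely positive map `Φ_X(Y) = ∑ⱼ Xⱼ Y Xⱼ*` of a row `X = (X₁, …, X_m)`. -/
def cpMap {m : ℕ} (X : Fin m → (H →L[ℂ] H)) : Module.End ℂ (H →L[ℂ] H) where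
  toFun Y := ∑ j, X j * Y * star (X j)
  map_add' Y Z := by simp only [mul_add, add_mul, Finset.sum_add_distrib]
  map_smul' c Y := by
    simp only [mul_smul_comm, smul_mul_assoc, Finset.smul_sum, RingHom.id_apply]

/-- The defect mapping `Δ_X^p = (id - Φ_{X₁})^{p₁} ∘ ⋯ ∘ (id - Φ_{X_k})^{p_k}`. -/
def defectMap {k : ℕ} {n : Fin k → ℕ} (X : OpTuple n H) (p : Fin k → ℕ) :
    Module.End ℂ (H →L[ℂ] H) :=
  (List.ofFn fun i => (1 - cpMap (X i)) ^ p i).prod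

/-- The defect operator `Δ_X(I) = (id - Φ_{X₁}) ∘ ⋯ ∘ (id - Φ_{X_k}) (I)`. -/
def defect {k : ℕ} {n : Fin k → ℕ} (X : OpTuple n H) : H →L[ℂ] H :=
  defectMap X (fun _ => 1) 1

variable (H) in
/-- The regular polyball `B_n(H)`: entries of different rows commute, and `Δ_X^p(I) ≥ 0` for all
`p ∈ {0,1}^k` (the order is the usual order of selfadjoint operators). -/
def regularPolyball {k : ℕ} (n : Fin k → ℕ) : Set (OpTuple n H) :=
  {X | (∀ s t, s ≠ t → ∀ a b, Commute (X s a) (X t b)) ∧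
    ∀ p : Fin k → ℕ, (∀ i, p i ≤ 1) → 0 ≤ defectMap X p 1}

/-- The range of the defect operator, a linear subspace of `H` (not closed in general). -/
def defectRange {k : ℕ} {n : Fin k → ℕ} (X : OpTuple n H) : Submodule ℂ H :=
  LinearMap.range (defect X : H →ₗ[ℂ] H)

/-- The closure of the range of the defect operator. -/
def defectSpace {k : ℕ} {n : Fin k → ℕ} (X : OpTuple n H) : Submodule ℂ H :=
  (defectRange X).topologicalClosure

instance instCompleteDefectSpace {k : ℕ} {n : Fin k → ℕ} (X : OpTuple n H) : CompleteSpace (defectSpace X) :=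
  inferInstanceAs (CompleteSpace (defectRange X).topologicalClosure)

/-- `X` has finite rank defect. -/
def HasFiniteRankDefect {k : ℕ} {n : Fin k → ℕ} (X : OpTuple n H) : Prop :=
  FiniteDimensional ℂ (defectRange X)

/-- `X_α = X_{j₁} ⋯ X_{j_p}` for a word `α = g_{j₁} ⋯ g_{j_p}`, and `I` for the empty word. -/
def wordOp {m : ℕ} (X : Fin m → (H →L[ℂ] H)) (α : FreeMonoid (Fin m)) : H →L[ℂ] H :=
  FreeMonoid.lift X α

/-- The product `X_{1,α₁} ⋯ X_{k,α_k}`. -/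
def wordsOp {k : ℕ} {n : Fin k → ℕ} (X : OpTuple n H) (α : Words n) : H →L[ℂ] H :=
  (List.ofFn fun i => wordOp (X i) (α i)).prod

/-- The product `X_{1,β₁}* ⋯ X_{k,β_k}*`. -/
def wordsStarOp {k : ℕ} {n : Fin k → ℕ} (X : OpTuple n H) (β : Words n) : H →L[ℂ] H :=
  (List.ofFn fun i => star (wordOp (X i) (β i))).prod

/-- The trace `∑ ⟨A b, b⟩ ∈ [0, ∞]` of a positive operator `A`, summed over an orthonormal basis of
the Hilbert space. It is used for positive operators only, where it does not depend on the
orthonormal basis. -/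
def posTrace (A : H →L[ℂ] H) : ℝ≥0∞ :=
  ∑' b : (exists_hilbertBasis ℂ H).choose, ENNReal.ofReal (RCLike.re ⟪(b : H), A b⟫_ℂ)

end Operators

/-! ### The full Fock spaces -/

/-- The Hilbert space `F²(H_{n₁}) ⊗ ⋯ ⊗ F²(H_{n_k}) ⊗ E`, realized through the orthonormal basis
`e_{β₁} ⊗ ⋯ ⊗ e_{β_k}` of the tensor product of the full Fock spaces as the space of
square-summable families `(f_β)` of vectors of `E` indexed by the words `β = (β₁, …, β_k)`; the
family stands for `∑_β e_{β₁} ⊗ ⋯ ⊗ e_{β_k} ⊗ f_β`. With `E = ℂ` it is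
`F²(H_{n₁}) ⊗ ⋯ ⊗ F²(H_{n_k})`. -/
abbrev FockTensor {k : ℕ} (n : Fin k → ℕ) (E : Type*) [NormedAddCommGroup E] : Type _ :=
  lp (fun _ : Words n => E) 2

section Fock

variable (E : Type*) [NormedAddCommGroup E] [InnerProductSpace ℂ E] [CompleteSpace E]

/-- The vector `e_{β₁} ⊗ ⋯ ⊗ e_{β_k} ⊗ x`. -/
def fockVec {k : ℕ} {n : Fin k → ℕ} (β : Words n) (x : E) : FockTensor n E :=
  haveI : DecidableEq (Words n) := Classical.decEq _
  lp.single 2 β x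

/-- The closed linear span of the vectors `e_{β₁} ⊗ ⋯ ⊗ e_{β_k} ⊗ x` with `|β_i| = q_i`. -/
def levelSpace {k : ℕ} (n : Fin k → ℕ) (q : Fin k → ℕ) : Submodule ℂ (FockTensor n E) :=
  (Submodule.span ℂ
    {f | ∃ (β : Words n) (x : E), (∀ i, (β i).length = q i) ∧ f = fockVec E β x}).topologicalClosure

instance instCompleteLevelSpace {k : ℕ} (n : Fin k → ℕ) (q : Fin k → ℕ) : CompleteSpace (levelSpace E n q) :=
  inferInstanceAs (CompleteSpace (Submodule.topologicalClosure _))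

/-- The orthogonal projection `P_{q₁}^{(1)} ⊗ ⋯ ⊗ P_{q_k}^{(k)} ⊗ I_E`. -/
def levelProj {k : ℕ} (n : Fin k → ℕ) (q : Fin k → ℕ) : FockTensor n E →L[ℂ] FockTensor n E :=
  (levelSpace E n q).starProjection

end Fock

/-! ### The noncommutative Berezin kernel -/

section Berezin

variable {H : Type*} [NormedAddCommGroup H] [InnerProductSpace ℂ H] [CompleteSpace H]

/-- The coefficient `Δ_X(I)^{1/2} X_{1,β₁}* ⋯ X_{k,β_k}* h` of the Berezin kernel. -/
def berezinCoeff {k : ℕ} {n : Fin k → ℕ} (X : OpTuple n H) (β : Words n) (h : H) : H :=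
  CFC.sqrt (defect X) (wordsStarOp X β h)

lemma defect_nonneg {k : ℕ} {n : Fin k → ℕ} {X : OpTuple n H} (hX : X ∈ regularPolyball H n) :
    0 ≤ defect X := hX.2 _ fun _ => le_rfl

lemma norm_sqrt_sq {A : H →L[ℂ] H} (hA : 0 ≤ A) (x : H) :
    ‖CFC.sqrt A x‖ ^ 2 = RCLike.re ⟪x, A x⟫_ℂ := by
  have hs : (CFC.sqrt A).IsPositive :=
    (ContinuousLinearMap.nonneg_iff_isPositive _).1 (CFC.sqrt_nonneg A)
  have h2 : A x = CFC.sqrt A (CFC.sqrt A x) := by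
    conv_lhs => rw [← CFC.sqrt_mul_sqrt_self A hA]
    rfl
  rw [h2, ← hs.inner_left_eq_inner_right, inner_self_eq_norm_sq]

lemma berezinCoeff_mem {k : ℕ} {n : Fin k → ℕ} {X : OpTuple n H} (hX : X ∈ regularPolyball H n)
    (β : Words n) (h : H) : berezinCoeff X β h ∈ defectSpace X := by
  have hA := defect_nonneg hX
  have hs : (CFC.sqrt (defect X)).IsPositive :=
    (ContinuousLinearMap.nonneg_iff_isPositive _).1 (CFC.sqrt_nonneg _)
  have hp : (defect X).IsPositive := (ContinuousLinearMap.nonneg_iff_isPositive _).1 hA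
  rw [defectSpace, ← Submodule.orthogonal_orthogonal_eq_closure, Submodule.mem_orthogonal]
  intro u hu
  have hu0 : defect X u = 0 := by
    rw [Submodule.mem_orthogonal] at hu
    have := hu (defect X (defect X u)) ⟨defect X u, rfl⟩
    rw [hp.inner_left_eq_inner_right, inner_self_eq_zero] at this
    exact this
  have hsu : CFC.sqrt (defect X) u = 0 := by
    have := norm_sqrt_sq hA u
    rw [hu0, inner_zero_right, map_zero] at this
    simpa using this
  rw [berezinCoeff, ← hs.inner_left_eq_inner_right, hsu, inner_zero_left]

lemma tsum_word_le {m : ℕ} (X : Fin m → (H →L[ℂ] H)) {Z : H →L[ℂ] H} (hZ : 0 ≤ Z)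
    (hd : 0 ≤ (1 - cpMap X) Z) (g : H) :
    ∑' α : FreeMonoid (Fin m), ENNReal.ofReal
      (RCLike.re ⟪star (wordOp X α) g, (1 - cpMap X) Z (star (wordOp X α) g)⟫_ℂ) ≤
      ENNReal.ofReal (RCLike.re ⟪g, Z g⟫_ℂ) := by
  classical
  have hZp : Z.IsPositive := (ContinuousLinearMap.nonneg_iff_isPositive _).1 hZ
  have hdp : ((1 - cpMap X) Z).IsPositive := (ContinuousLinearMap.nonneg_iff_isPositive _).1 hd
  set f : H → ℝ := fun x => RCLike.re ⟪x, (1 - cpMap X) Z x⟫_ℂ with hf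
  have hf0 : ∀ x, 0 ≤ f x := fun x => hdp.re_inner_nonneg_right x
  have hfe : ∀ x, f x = RCLike.re ⟪x, Z x⟫_ℂ -
      ∑ j, RCLike.re ⟪star (X j) x, Z (star (X j) x)⟫_ℂ := by
    intro x
    have : (1 - cpMap X) Z x = Z x - ∑ j, X j (Z (star (X j) x)) := by
      simp [cpMap]
    simp only [hf, this, inner_sub_right, inner_sum, map_sub, map_sum,
      ContinuousLinearMap.star_eq_adjoint, ContinuousLinearMap.adjoint_inner_left]
  have key : ∀ N : ℕ, ∀ F : Finset (FreeMonoid (Fin m)), (∀ α ∈ F, α.length < N) → ∀ x : H,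
      ∑ α ∈ F, f (star (wordOp X α) x) ≤ RCLike.re ⟪x, Z x⟫_ℂ := by
    intro N
    induction N with
    | zero =>
      intro F hF x
      have : F = ∅ := Finset.eq_empty_of_forall_notMem fun α hα => absurd (hF α hα) (by omega)
      rw [this, Finset.sum_empty]
      exact hZp.re_inner_nonneg_right x
    | succ N ih =>
      intro F hF x
      let c : Fin m → FreeMonoid (Fin m) → FreeMonoid (Fin m) := fun j α => FreeMonoid.of j * α
      have hc : ∀ j, Function.Injective (c j) := fun j => mul_right_injective _
      let G : Fin m → Finset (FreeMonoid (Fin m)) := fun j => F.preimage (c j) (hc j).injOn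
      have hsub : F ⊆ {1} ∪ Finset.univ.biUnion fun j => (G j).image (c j) := by
        intro α hα
        induction α using FreeMonoid.casesOn with
        | one => simp
        | of_mul j α =>
          refine Finset.mem_union_right _ (Finset.mem_biUnion.2 ⟨j, Finset.mem_univ _, ?_⟩)
          exact Finset.mem_image.2 ⟨α, Finset.mem_preimage.2 hα, rfl⟩
      have hnn : ∀ α, 0 ≤ f (star (wordOp X α) x) := fun α => hf0 _
      have hG : ∀ j, ∑ α ∈ G j, f (star (wordOp X (c j α)) x) ≤
          RCLike.re ⟪star (X j) x, Z (star (X j) x)⟫_ℂ := by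
        intro j
        have := ih (G j) (fun α hα => by
          have := hF _ (Finset.mem_preimage.1 hα)
          simp only [c, FreeMonoid.length_mul, FreeMonoid.length_of] at this
          omega) (star (X j) x)
        refine le_of_eq_of_le (Finset.sum_congr rfl fun α _ => ?_) this
        have : wordOp X (c j α) = X j * wordOp X α := by
          simp [wordOp, c]
        rw [this, star_mul]
        rfl
      calc ∑ α ∈ F, f (star (wordOp X α) x)
          ≤ ∑ α ∈ {1} ∪ Finset.univ.biUnion fun j => (G j).image (c j),
              f (star (wordOp X α) x) :=
            Finset.sum_le_sum_of_subset_of_nonneg hsub fun α _ _ => hnn α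
        _ ≤ f (star (wordOp X 1) x) +
              ∑ α ∈ Finset.univ.biUnion fun j => (G j).image (c j),
                f (star (wordOp X α) x) := by
            have := Finset.sum_union_inter (s₁ := {1})
              (s₂ := Finset.univ.biUnion fun j => (G j).image (c j))
              (f := fun α => f (star (wordOp X α) x))
            have h3 := Finset.sum_nonneg (s := {1} ∩ Finset.univ.biUnion fun j =>
              (G j).image (c j)) fun α _ => hnn α
            rw [Finset.sum_singleton] at this
            linarith
        _ = f x + ∑ j, ∑ α ∈ G j, f (star (wordOp X (c j α)) x) := by
            congr 1
            · simp [wordOp]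
            · rw [Finset.sum_biUnion]
              · exact Finset.sum_congr rfl fun j _ => Finset.sum_image (hc j).injOn
              · intro i _ j _ hij
                refine Finset.disjoint_left.2 fun α hi hj => hij ?_
                obtain ⟨a, -, rfl⟩ := Finset.mem_image.1 hi
                obtain ⟨b, -, hb⟩ := Finset.mem_image.1 hj
                have : FreeMonoid.toList (c j b) = FreeMonoid.toList (c i a) := by rw [hb]
                simp only [c, FreeMonoid.toList_mul, FreeMonoid.toList_of, List.singleton_append,
                  List.cons.injEq] at this
                exact this.1.symm
        _ ≤ RCLike.re ⟪x, Z x⟫_ℂ := by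
            have := Finset.sum_le_sum fun j (_ : j ∈ Finset.univ) => hG j
            have := hfe x
            linarith
  rw [ENNReal.tsum_eq_iSup_sum]
  refine iSup_le fun F => ?_
  rw [← ENNReal.ofReal_sum_of_nonneg fun α _ => hf0 _]
  refine ENNReal.ofReal_le_ofReal (key (F.sup FreeMonoid.length + 1) F (fun α hα => ?_) g)
  exact Nat.lt_succ_of_le (Finset.le_sup (f := FreeMonoid.length) hα)

lemma tsum_words_le {k : ℕ} {n : Fin k → ℕ} (X : OpTuple n H)
    (hX : ∀ p : Fin k → ℕ, (∀ i, p i ≤ 1) → 0 ≤ defectMap X p 1) (h : H) :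
    ∑' β : Words n, ENNReal.ofReal
      (RCLike.re ⟪wordsStarOp X β h, defect X (wordsStarOp X β h)⟫_ℂ) ≤
      ENNReal.ofReal (‖h‖ ^ 2) := by
  induction k with
  | zero =>
    have : Unique (Words n) := inferInstanceAs (Unique ((i : Fin 0) → FreeMonoid (Fin (n i))))
    rw [tsum_fintype, Fintype.sum_unique]
    have h1 : ∀ β : Words n, wordsStarOp X β h = h := fun β => by simp [wordsStarOp]
    have h2 : defect X = 1 := by simp [defect, defectMap]
    rw [h1, h2, one_apply_eq_self, inner_self_eq_norm_sq]
  | succ k ih =>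
    have hcons : ∀ (r : ℕ) (p : Fin k → ℕ), defectMap X (Fin.cons r p) 1 =
        ((1 - cpMap (X 0)) ^ r) (defectMap (fun i => X i.succ) p 1) := by
      intro r p
      simp [defectMap, List.ofFn_succ]
    have hX' : ∀ p : Fin k → ℕ, (∀ i, p i ≤ 1) →
        0 ≤ defectMap (fun i : Fin k => X i.succ) p 1 := by
      intro p hp
      have := hX (Fin.cons 0 p) (Fin.cases (by simp) (by simpa using hp))
      rwa [hcons, pow_zero, Module.End.one_apply] at this
    have hdef : defect X = (1 - cpMap (X 0)) (defect fun i : Fin k => X i.succ) := by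
      have := hcons 1 (fun _ => 1)
      rw [pow_one] at this
      rw [defect, defect, ← this]
      congr 2
      funext i
      refine Fin.cases ?_ (fun j => ?_) i <;> simp
    have hZ : 0 ≤ defect fun i : Fin k => X i.succ := hX' _ fun _ => le_rfl
    have hd : 0 ≤ (1 - cpMap (X 0)) (defect fun i : Fin k => X i.succ) := by
      rw [← hdef]
      exact hX _ fun _ => le_rfl
    refine le_trans ?_ (ih (fun i => X i.succ) hX')
    let e := Fin.consEquiv (fun i : Fin (k + 1) => FreeMonoid (Fin (n i)))
    rw [← e.tsum_eq, ENNReal.tsum_prod', ENNReal.tsum_comm]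
    refine ENNReal.tsum_le_tsum fun β => ?_
    refine le_of_eq_of_le (tsum_congr fun α => ?_) (tsum_word_le (X 0) hZ hd _)
    have : wordsStarOp X (e (α, β)) =
        star (wordOp (X 0) α) * wordsStarOp (fun i : Fin k => X i.succ) β := by
      simp [wordsStarOp, List.ofFn_succ, e, Fin.consEquiv]
    rw [this, hdef]
    rfl

lemma tsum_berezinCoeff_le {k : ℕ} {n : Fin k → ℕ} {X : OpTuple n H}
    (hX : X ∈ regularPolyball H n) (h : H) :
    (Summable fun β => ‖berezinCoeff X β h‖ ^ 2) ∧
      ∑' β, ‖berezinCoeff X β h‖ ^ 2 ≤ ‖h‖ ^ 2 := by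
  have hle : ∑' β : Words n, ENNReal.ofReal (‖berezinCoeff X β h‖ ^ 2) ≤
      ENNReal.ofReal (‖h‖ ^ 2) := by
    simp only [berezinCoeff, norm_sqrt_sq (defect_nonneg hX)]
    exact tsum_words_le X hX.2 h
  have hs : Summable fun β => ‖berezinCoeff X β h‖ ^ 2 := by
    have := ENNReal.summable_toReal (ne_top_of_le_ne_top ENNReal.ofReal_ne_top hle)
    simpa only [ENNReal.toReal_ofReal (sq_nonneg _)] using this
  refine ⟨hs, ?_⟩
  rw [← ENNReal.ofReal_tsum_of_nonneg (fun _ => sq_nonneg _) hs] at hle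
  exact (ENNReal.ofReal_le_ofReal_iff (sq_nonneg _)).1 hle

lemma berezin_memℓp {k : ℕ} {n : Fin k → ℕ} {X : OpTuple n H}
    (hX : X ∈ regularPolyball H n) (h : H) :
    Memℓp (fun β => (⟨berezinCoeff X β h, berezinCoeff_mem hX β h⟩ : defectSpace X)) 2 := by
  refine memℓp_gen ?_
  simpa using (tsum_berezinCoeff_le hX h).1

/-- The noncommutative Berezin kernel
`K_X : H → F²(H_{n₁}) ⊗ ⋯ ⊗ F²(H_{n_k}) ⊗ closure (Δ_X(I) H)`,
`K_X h = ∑_β e_{β₁} ⊗ ⋯ ⊗ e_{β_k} ⊗ Δ_X(I)^{1/2} X_{1,β₁}* ⋯ X_{k,β_k}* h`, a contraction. -/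
def berezinKernel {k : ℕ} {n : Fin k → ℕ} {X : OpTuple n H} (hX : X ∈ regularPolyball H n) :
    H →L[ℂ] FockTensor n (defectSpace X) :=
  LinearMap.mkContinuous
    { toFun := fun h => ⟨fun β => ⟨berezinCoeff X β h, berezinCoeff_mem hX β h⟩,
        berezin_memℓp hX h⟩
      map_add' := fun h h' => by
        ext β
        simp only [berezinCoeff, map_add]
        rfl
      map_smul' := fun c h => by
        ext β
        simp [berezinCoeff] }
    1 (fun h => by
      rw [one_mul]
      refine lp.norm_le_of_tsum_le (by simp) (norm_nonneg h) ?_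
      simpa using (tsum_berezinCoeff_le hX h).2)

/-! ### Curvature and Euler characteristic -/

/-- The operator `K_X* (P_{q₁}^{(1)} ⊗ ⋯ ⊗ P_{q_k}^{(k)} ⊗ I) K_X` on `H`. -/
def berezinLevel {k : ℕ} {n : Fin k → ℕ} {X : OpTuple n H} (hX : X ∈ regularPolyball H n)
    (q : Fin k → ℕ) : H →L[ℂ] H :=
  (berezinKernel hX).adjoint ∘L levelProj (defectSpace X) n q ∘L berezinKernel hX

/-- The `m`-th average
`(m+k choose k)⁻¹ ∑_{q₁+⋯+q_k ≤ m} trace [K_X* (P_q ⊗ I) K_X] / trace [P_q]`,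
with `P_q = P_{q₁}^{(1)} ⊗ ⋯ ⊗ P_{q_k}^{(k)}`. -/
def curvAverage {k : ℕ} {n : Fin k → ℕ} {X : OpTuple n H} (hX : X ∈ regularPolyball H n)
    (m : ℕ) : ℝ :=
  (1 / ((m + k).choose k : ℝ)) *
    ∑ q ∈ (Fintype.piFinset fun _ : Fin k => Finset.range (m + 1)) with ∑ i, q i ≤ m,
      (posTrace (berezinLevel hX q)).toReal / (posTrace (levelProj ℂ n q)).toReal

/-- `curv(X)` exists and equals `c`. -/
def IsCurvature {k : ℕ} {n : Fin k → ℕ} {X : OpTuple n H} (hX : X ∈ regularPolyball H n)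
    (c : ℝ) : Prop :=
  Tendsto (curvAverage hX) atTop (𝓝 c)

/-- `M_q(X) = span {X_{1,α₁} ⋯ X_{k,α_k} h : |α_i| ≤ q_i, h ∈ Δ_X(I) H}`. -/
def wordSpan {k : ℕ} {n : Fin k → ℕ} (X : OpTuple n H) (q : Fin k → ℕ) : Submodule ℂ H :=
  Submodule.span ℂ
    {v | ∃ (α : Words n) (h : H), (∀ i, (α i).length ≤ q i) ∧ h ∈ defectRange X ∧
      v = wordsOp X α h}

/-- The quotient `dim M_q(X) / ∏ᵢ (1 + n_i + ⋯ + n_i^{q_i})`. -/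
def eulerRatio {k : ℕ} {n : Fin k → ℕ} (X : OpTuple n H) (q : Fin k → ℕ) : ℝ :=
  (Module.finrank ℂ (wordSpan X q) : ℝ) /
    ∏ i, ∑ s ∈ Finset.range (q i + 1), (n i : ℝ) ^ s

/-- `χ(X)` exists and equals `x`: the quotients converge to `x` along every increasing cofinal
sequence in `ℤ₊^k` (coordinatewise order). -/
def IsEulerChar {k : ℕ} {n : Fin k → ℕ} (X : OpTuple n H) (x : ℝ) : Prop :=
  ∀ q : ℕ → Fin k → ℕ, Monotone q → (∀ p, ∃ m, p ≤ q m) →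
    Tendsto (fun m => eulerRatio X (q m)) atTop (𝓝 x)

end Berezin

end NCPolyball

end

noncomputable section

namespace NCPolyball

set_option linter.unusedSectionVars false

/-! ### Functions on `ℕ^k` and averages over simplices -/

/-! Both invariants are infima of antitone functions on `ℕ^k`, and these can be compared at each
`q`.

Let `w(β)` be the squared Hilbert-Schmidt norm of `T_β Δ^{1/2}` (`wordWeight`). The trace of `K*
(P_q ⊗ I) K` is the sum of `w` over the words of level `q` (`posTrace_berezinLevel`). The `T_{i,j}`
are contractions, so a new letter in front does not increase `w`. Raising `q_i` by one replaces each
word by `n_i` words, so the sum grows at most by the factor `n_i`, and `b(q)`, the sum divided by `∏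
n_i^{q_i}`, is antitone (`levelRatio_antitone`). Simplex averages of such a function tend to its
infimum, because all but a vanishing fraction of the simplex lies above any given point
(`tendsto_simplexAverage`). Hence `curv = inf b`.

For `χ`, increase one coordinate at a time. A row maps each `M_q` into the next one, so only a
complement of the previous space can produce new dimensions: each increment of the dimension is at
most `n_i` times the one before (`finrank_add_le_of_map_le`). Hence the Euler ratio is antitone
(`eulerRatio_antitone`), and its limit along any cofinal sequence is its infimum.

For `curv ≤ χ`, the vectors `T_β Δ^{1/2} v` with `β` of level at most `q` lie in `M_q`, and `K` is a
contraction. Testing on an orthonormal basis of `M_q` gives `∑_{p ≤ q} b(p) ∏ n_i^{p_i} ≤ dim M_q`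
(`sum_wordWeight_le_finrank`). The left side is at least `inf b` times the denominator of the Euler
ratio. Finally `χ` is at most the ratio at `q = 0`, which is at most the rank of the defect. -/

lemma antitone_of_update_succ_le {k : ℕ} {f : (Fin k → ℕ) → ℝ}
    (h : ∀ q i, f (Function.update q i (q i + 1)) ≤ f q) : Antitone f := by
  refine (antitone_iff_forall_covBy f).2 fun p q hpq => ?_
  obtain ⟨i, x, hx, rfl⟩ := Pi.covBy_iff_exists_right_eq.1 hpq
  rw [Nat.covBy_iff_add_one_eq] at hx
  exact hx ▸ h p i

/-- The lattice points `q ∈ ℕ^k` with `q₁ + ⋯ + q_k ≤ m`. -/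
def latticeSimplex (k m : ℕ) : Finset (Fin k → ℕ) :=
  (Fintype.piFinset fun _ : Fin k => Finset.range (m + 1)).filter fun q => ∑ i, q i ≤ m

lemma mem_latticeSimplex {k m : ℕ} {q : Fin k → ℕ} :
    q ∈ latticeSimplex k m ↔ ∑ i, q i ≤ m := by
  simp only [latticeSimplex, Finset.mem_filter, Fintype.mem_piFinset, Finset.mem_range,
    and_iff_right_iff_imp]
  intro h i
  have := Finset.single_le_sum (f := q) (fun _ _ => Nat.zero_le _) (Finset.mem_univ i)
  omega

/-- Slicing by the first coordinate `t` leaves a simplex of size `m - t` in one dimension less; the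
slices add up by the hockey-stick identity. -/
lemma card_latticeSimplex (k m : ℕ) : (latticeSimplex k m).card = (m + k).choose k := by
  induction k generalizing m with
  | zero =>
    have : latticeSimplex 0 m = Finset.univ := by
      ext q
      exact iff_of_true (by simp [mem_latticeSimplex]) (Finset.mem_univ _)
    simp [this]
  | succ k ih =>
    have h1 : (latticeSimplex (k + 1) m).card =
        ((Finset.range (m + 1)).sigma fun t => latticeSimplex k (m - t)).card := by
      refine Finset.card_nbij' (fun q => ⟨q 0, Fin.tail q⟩) (fun p => Fin.cons p.1 p.2) ?_ ?_ ?_ ?_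
      · intro q hq
        simp only [Finset.mem_coe, mem_latticeSimplex, Fin.sum_univ_succ, Finset.mem_sigma,
          Finset.mem_range, Fin.tail] at hq ⊢
        omega
      · rintro ⟨t, q⟩ hq
        simp only [Finset.mem_coe, mem_latticeSimplex, Fin.sum_univ_succ, Finset.mem_sigma,
          Finset.mem_range, Fin.cons_zero, Fin.cons_succ] at hq ⊢
        omega
      · intro q _
        exact Fin.cons_self_tail q
      · rintro ⟨t, q⟩ _
        simp
    rw [h1, Finset.card_sigma, Finset.sum_congr rfl fun t _ => ih (m - t),
      ← add_assoc m k 1, ← Nat.sum_range_add_choose m k, ← Finset.sum_range_reflect]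
    refine Finset.sum_congr rfl fun t ht => ?_
    rw [Finset.mem_range] at ht
    congr 2
    omega

lemma tendsto_choose_ratio (k c : ℕ) :
    Tendsto (fun m : ℕ => (((m + k).choose k : ℕ) : ℝ) / ((m + c + k).choose k : ℕ)) atTop
      (𝓝 1) := by
  have hpos : ∀ m : ℕ, (0 : ℝ) < ((m + k).choose k : ℕ) := fun m => by
    exact_mod_cast Nat.choose_pos (Nat.le_add_left _ _)
  induction c with
  | zero =>
    simp only [add_zero, div_self (hpos _).ne']
    exact tendsto_const_nhds
  | succ c ih =>
    have h1 : Tendsto (fun m : ℕ => (((m + c + k).choose k : ℕ) : ℝ) /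
        ((m + c + 1 + k).choose k : ℕ)) atTop (𝓝 1) := by
      have h2 : Tendsto (fun m : ℕ => 1 - (k : ℝ) / ((m : ℝ) + (c + 1 + k))) atTop (𝓝 (1 - 0)) :=
        tendsto_const_nhds.sub (tendsto_const_nhds.div_atTop
          (tendsto_atTop_add_const_right _ _ tendsto_natCast_atTop_atTop))
      rw [sub_zero] at h2
      refine h2.congr fun m => ?_
      -- The identity `C(N,k) (N+1) = C(N+1,k) (N+1-k)` for `N = m + c + k`; it makes the one-step
      -- ratio `1 - k/(N+1)`.
      have h3 : ((m + c + k).choose k : ℝ) * (m + c + 1 + k) =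
          ((m + c + 1 + k).choose k : ℝ) * (m + c + 1) := by
        have := Nat.choose_mul_succ_eq (m + c + k) k
        rw [show m + c + k + 1 - k = m + c + 1 by omega,
          show m + c + k + 1 = m + c + 1 + k by omega] at this
        exact_mod_cast this
      have h4 : (0 : ℝ) < (m : ℝ) + c + 1 + k := by positivity
      rw [eq_div_iff (hpos (m + c + 1)).ne',
        show (m : ℝ) + (c + 1 + k) = m + c + 1 + k by ring]
      field_simp
      linarith
    have := ih.mul h1
    rw [one_mul] at this
    refine this.congr fun m => ?_
    rw [div_mul_div_cancel₀ (hpos (m + c)).ne', add_assoc m c 1]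

/-- The simplex averages of a nonnegative antitone function on `ℕ^k` converge to its infimum. -/
lemma tendsto_simplexAverage {k : ℕ} {b : (Fin k → ℕ) → ℝ} (hb : Antitone b)
    (h0 : ∀ q, 0 ≤ b q) :
    Tendsto (fun m => (1 / ((m + k).choose k : ℝ)) * ∑ q ∈ latticeSimplex k m, b q) atTop
      (𝓝 (⨅ q, b q)) := by
  have hbdd : BddBelow (Set.range b) := ⟨0, by rintro _ ⟨q, rfl⟩; exact h0 q⟩
  have hpos : ∀ m : ℕ, (0 : ℝ) < ((m + k).choose k : ℕ) := fun m => by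
    exact_mod_cast Nat.choose_pos (Nat.le_add_left _ _)
  set L := ⨅ q, b q with hL
  have hlow : ∀ m : ℕ, L ≤ (1 / ((m + k).choose k : ℝ)) * ∑ q ∈ latticeSimplex k m, b q := by
    intro m
    have := Finset.card_nsmul_le_sum (latticeSimplex k m) b L fun q _ => ciInf_le hbdd q
    rw [card_latticeSimplex, nsmul_eq_mul] at this
    rwa [one_div, ← div_eq_inv_mul, le_div_iff₀ (hpos m), mul_comm]
  refine tendsto_order.2 ⟨fun a ha => Eventually.of_forall fun m => ha.trans_le (hlow m),
    fun a ha => ?_⟩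
  obtain ⟨p, hp⟩ := exists_lt_of_ciInf_lt ha
  let c := ∑ i, p i
  -- The translate by `p` of the simplex of size `m` sits inside the simplex of size `m + c`. There
  -- `b ≤ b p`, and elsewhere `b ≤ b 0`; the fraction of points in the translate tends to 1.
  have hup : ∀ m : ℕ, (1 / ((m + c + k).choose k : ℝ)) * ∑ q ∈ latticeSimplex k (m + c), b q ≤
      b 0 + (b p - b 0) * (((m + k).choose k : ℝ) / ((m + c + k).choose k : ℝ)) := by
    intro m
    let G := (latticeSimplex k m).image fun q => q + p
    have hinj : Function.Injective fun q : Fin k → ℕ => q + p := add_left_injective p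
    have hG : G ⊆ latticeSimplex k (m + c) := by
      intro q hq
      obtain ⟨r, hr, rfl⟩ := Finset.mem_image.1 hq
      rw [mem_latticeSimplex] at hr ⊢
      simp only [Pi.add_apply, Finset.sum_add_distrib, c]
      omega
    have hGc : G.card = (m + k).choose k := by
      rw [Finset.card_image_of_injective _ hinj, card_latticeSimplex]
    -- After subtracting `b 0` every term is nonpositive, so discarding the points outside `G` can
    -- only increase the sum.
    have h1 : ∑ q ∈ latticeSimplex k (m + c), (b q - b 0) ≤ ∑ q ∈ G, (b q - b 0) := by
      rw [← Finset.sum_sdiff hG]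
      have : ∑ q ∈ latticeSimplex k (m + c) \ G, (b q - b 0) ≤ 0 :=
        Finset.sum_nonpos fun q _ => sub_nonpos.2 (hb (zero_le : 0 ≤ q))
      linarith
    have h2 : ∑ q ∈ G, (b q - b 0) ≤ G.card • (b p - b 0) := by
      refine Finset.sum_le_card_nsmul _ _ _ fun q hq => ?_
      obtain ⟨r, -, rfl⟩ := Finset.mem_image.1 hq
      exact sub_le_sub_right (hb (le_add_of_nonneg_left (zero_le : 0 ≤ r))) _
    rw [Finset.sum_sub_distrib, Finset.sum_const, card_latticeSimplex, nsmul_eq_mul] at h1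
    rw [hGc, nsmul_eq_mul] at h2
    have h3 := h1.trans h2
    have := hpos (m + c)
    rw [← sub_nonneg]
    have h4 : b 0 + (b p - b 0) * (((m + k).choose k : ℝ) / ((m + c + k).choose k : ℝ)) -
        (1 / ((m + c + k).choose k : ℝ)) * ∑ q ∈ latticeSimplex k (m + c), b q =
        (((m + c + k).choose k : ℝ) * b 0 + (b p - b 0) * ((m + k).choose k : ℝ) -
          ∑ q ∈ latticeSimplex k (m + c), b q) / ((m + c + k).choose k : ℝ) := by
      field_simp
    rw [h4]
    exact div_nonneg (by linarith) this.le
  have hlim := ((tendsto_choose_ratio k c).const_mul (b p - b 0)).const_add (b 0)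
  rw [mul_one, add_sub_cancel] at hlim
  have hev := (hlim.eventually_lt_const hp).mono fun m hm => (hup m).trans_lt hm
  obtain ⟨M, hM⟩ := eventually_atTop.1 hev
  refine eventually_atTop.2 ⟨M + c, fun m hm => ?_⟩
  have := hM (m - c) (by omega)
  rwa [show m - c + c = m by omega] at this

/-! ### Growth of dimensions -/

/-- Cross-multiplied, the claim is `key`: the next increment times the geometric sum is at most
`n^(t+1) D t`. This propagates by induction because increments grow at most by the factor `n`; `hD`
is the start, the increment before it being `D 0` itself. -/
lemma div_geomSum_succ_le {n : ℕ} {D : ℕ → ℝ} (hD : D 1 - D 0 ≤ n * D 0)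
    (hstep : ∀ t, D (t + 2) - D (t + 1) ≤ n * (D (t + 1) - D t)) (t : ℕ) :
    D (t + 1) / ∑ s ∈ Finset.range (t + 1 + 1), (n : ℝ) ^ s ≤
      D t / ∑ s ∈ Finset.range (t + 1), (n : ℝ) ^ s := by
  have hpos : ∀ t, (0 : ℝ) < ∑ s ∈ Finset.range (t + 1), (n : ℝ) ^ s := fun t => by
    rw [Finset.sum_range_succ']
    positivity
  have key : ∀ t, (D (t + 1) - D t) * ∑ s ∈ Finset.range (t + 1), (n : ℝ) ^ s ≤
      (n : ℝ) ^ (t + 1) * D t := by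
    intro t
    induction t with
    | zero => simpa using hD
    | succ t ih =>
      have h1 := mul_le_mul_of_nonneg_right (hstep t) (hpos (t + 1)).le
      have h2 := mul_le_mul_of_nonneg_left ih (Nat.cast_nonneg (α := ℝ) n)
      rw [Finset.sum_range_succ _ (t + 1)] at h1 ⊢
      refine h1.trans ?_
      rw [pow_succ _ (t + 1)]
      linarith
  rw [div_le_div_iff₀ (hpos _) (hpos _), Finset.sum_range_succ _ (t + 1)]
  linarith [key t]

section Dimension

variable {K V : Type*} [Field K] [AddCommGroup V] [Module K V]

lemma finrank_iSup_map_le {m : ℕ} (f : Fin m → V →ₗ[K] V) (E : Submodule K V)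
    [FiniteDimensional K E] :
    Module.finrank K (⨆ j, E.map (f j) : Submodule K V) ≤ m * Module.finrank K E := by
  have h : ∀ s : Finset (Fin m), Module.finrank K (s.sup fun j => E.map (f j) : Submodule K V) ≤
      s.card * Module.finrank K E := by
    intro s
    induction s using Finset.induction_on with
    | empty => simp
    | insert a s ha ih =>
      rw [Finset.sup_insert, Finset.card_insert_of_notMem ha]
      have := Submodule.finrank_add_le_finrank_add_finrank (E.map (f a))
        (s.sup fun j => E.map (f j))
      have h2 := Submodule.finrank_map_le (f a) E
      linarith
  have := h Finset.univ
  rwa [Finset.sup_univ_eq_iSup, Finset.card_univ, Fintype.card_fin] at this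

/-- If `f₁, …, f_m` map `A ≤ B` into `B`, then passing from `B` to `B + ∑ f_j B` adds at most
`m (dim B - dim A)` dimensions. -/
lemma finrank_add_le_of_map_le {m : ℕ} (f : Fin m → V →ₗ[K] V) {A B C : Submodule K V}
    [FiniteDimensional K B] (hAB : A ≤ B) (hA : ∀ j, A.map (f j) ≤ B)
    (hC : C ≤ B ⊔ ⨆ j, B.map (f j)) :
    Module.finrank K C + m * Module.finrank K A ≤
      Module.finrank K B + m * Module.finrank K B := by
  -- Split `B = A ⊕ E`. The images of `A` already lie in `B`, so only the `m` images of `E` can be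
  -- new, and `dim E = dim B - dim A`.
  obtain ⟨E₀, hE₀⟩ := exists_isCompl A
  let E := E₀ ⊓ B
  have hEB : E ≤ B := inf_le_right
  have : FiniteDimensional K A := Submodule.finiteDimensional_of_le hAB
  have : FiniteDimensional K E := Submodule.finiteDimensional_of_le hEB
  have hsup : A ⊔ E = B := by
    rw [← sup_inf_assoc_of_le E₀ hAB, hE₀.sup_eq_top, top_inf_eq]
  have hinf : A ⊓ E = ⊥ := by
    rw [eq_bot_iff, ← hE₀.inf_eq_bot]
    exact inf_le_inf_left _ inf_le_left
  have hdim := Submodule.finrank_sup_add_finrank_inf_eq A E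
  rw [hsup, hinf, finrank_bot, add_zero] at hdim
  have hCE : C ≤ B ⊔ ⨆ j, E.map (f j) := by
    refine hC.trans (sup_le le_sup_left (iSup_le fun j => ?_))
    rw [← hsup, Submodule.map_sup]
    refine sup_le ((hA j).trans ?_) (le_sup_of_le_right (le_iSup (fun j => E.map (f j)) j))
    rw [hsup]
    exact le_sup_left
  have h1 := Submodule.finrank_mono hCE
  have h2 := Submodule.finrank_add_le_finrank_add_finrank B (⨆ j, E.map (f j))
  have h3 := finrank_iSup_map_le f E
  rw [hdim, mul_add, ← hdim]
  linarith

end Dimension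

/-! ### Products over rows -/

section Products

variable {M : Type*} [Monoid M] {k : ℕ}

lemma prod_ofFn_eq_one {f : Fin k → M} (h : ∀ i, f i = 1) : (List.ofFn f).prod = 1 := by
  rw [funext h]
  simp [List.ofFn_const]

lemma prod_ofFn_update_mul {f : Fin k → M} {i : Fin k} {x : M}
    (h : ∀ l, l ≠ i → Commute x (f l)) :
    (List.ofFn (Function.update f i (x * f i))).prod = x * (List.ofFn f).prod := by
  induction k with
  | zero => exact i.elim0
  | succ k ih =>
    rw [List.ofFn_succ, List.ofFn_succ, List.prod_cons, List.prod_cons]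
    refine Fin.cases (fun h => ?_) (fun i h => ?_) i h
    · simp [mul_assoc]
    · have h1 := ih (f := fun l => f l.succ) (i := i) fun l hl =>
        h l.succ fun h => hl (Fin.succ_injective _ h)
      have h2 : (fun l : Fin k => Function.update f i.succ (x * f i.succ) l.succ) =
          Function.update (fun l => f l.succ) i (x * f i.succ) := by
        funext l
        rcases eq_or_ne l i with rfl | hl
        · simp
        · simp [hl]
      rw [h2, h1, Function.update_of_ne (Fin.succ_ne_zero i).symm, ← mul_assoc, ← mul_assoc,
        (h 0 (Fin.succ_ne_zero i).symm).eq]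

lemma prod_ofFn_single (i : Fin k) (x : M) :
    (List.ofFn (Function.update (fun _ => 1) i x)).prod = x := by
  have := prod_ofFn_update_mul (f := fun _ : Fin k => (1 : M)) (i := i) (x := x)
    fun _ _ => Commute.one_right x
  rwa [mul_one, prod_ofFn_eq_one fun _ => rfl, mul_one] at this

/-- The star reverses the product, and commutativity of the factors permits restoring the order. -/
lemma star_prod_ofFn [StarMul M] {f : Fin k → M} (h : ∀ i j, i ≠ j → Commute (f i) (f j)) :
    star (List.ofFn f).prod = (List.ofFn fun i => star (f i)).prod := by
  have h1 : star (List.ofFn f).prod = ((List.ofFn f).map star).reverse.prod := by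
    generalize List.ofFn f = l
    induction l with
    | nil => simp
    | cons a l ih => simp [ih]
  rw [h1, List.map_ofFn]
  refine (List.reverse_perm _).symm.prod_eq' ?_ |>.symm
  rw [List.pairwise_ofFn]
  intro i j hij
  exact (h i j hij.ne).star_star

end Products

/-! ### Words of given lengths -/

section WordSets

lemma of_mul_inj {m : ℕ} {a b : Fin m} {α β : FreeMonoid (Fin m)} :
    FreeMonoid.of a * α = FreeMonoid.of b * β ↔ a = b ∧ α = β := by
  refine ⟨fun h => ?_, fun ⟨h, h'⟩ => h ▸ h' ▸ rfl⟩
  have : FreeMonoid.toList (FreeMonoid.of a * α) = FreeMonoid.toList (FreeMonoid.of b * β) := by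
    rw [h]
  simpa using this

/-- Putting a letter in front of a word. -/
def consEmbedding (m : ℕ) : Fin m × FreeMonoid (Fin m) ↪ FreeMonoid (Fin m) where
  toFun p := FreeMonoid.of p.1 * p.2
  inj' _ _ h := Prod.ext_iff.2 (of_mul_inj.1 h)

lemma consEmbedding_apply {m : ℕ} (p : Fin m × FreeMonoid (Fin m)) :
    consEmbedding m p = FreeMonoid.of p.1 * p.2 := rfl

/-- The words of length `l` in `m` letters. -/
def wordsOfLength (m : ℕ) : ℕ → Finset (FreeMonoid (Fin m))
  | 0 => {1}
  | l + 1 => (Finset.univ ×ˢ wordsOfLength m l).map (consEmbedding m)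

lemma mem_wordsOfLength {m l : ℕ} {α : FreeMonoid (Fin m)} :
    α ∈ wordsOfLength m l ↔ α.length = l := by
  induction l generalizing α with
  | zero => simp [wordsOfLength, FreeMonoid.length_eq_zero]
  | succ l ih =>
    simp only [wordsOfLength, Finset.mem_map, Finset.mem_product, Finset.mem_univ, true_and, ih,
      consEmbedding_apply, Prod.exists]
    constructor
    · rintro ⟨j, α, h, rfl⟩
      simp [h, add_comm]
    · intro h
      induction α using FreeMonoid.casesOn with
      | one => simp at h
      | of_mul j α =>
        refine ⟨j, α, ?_, rfl⟩
        simp only [FreeMonoid.length_mul, FreeMonoid.length_of] at h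
        omega

lemma card_wordsOfLength (m l : ℕ) : (wordsOfLength m l).card = m ^ l := by
  induction l with
  | zero => simp [wordsOfLength]
  | succ l ih => simp [wordsOfLength, ih, pow_succ, mul_comm]

variable {k : ℕ} {n : Fin k → ℕ}

/-- The tuples of words `(β₁, …, β_k)` with `|β_i| = q_i`. -/
def wordLevel (n : Fin k → ℕ) (q : Fin k → ℕ) : Finset (Words n) :=
  Fintype.piFinset fun i => wordsOfLength (n i) (q i)

lemma mem_wordLevel {q : Fin k → ℕ} {β : Words n} :
    β ∈ wordLevel n q ↔ ∀ i, (β i).length = q i := by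
  simp [wordLevel, mem_wordsOfLength]

lemma card_wordLevel (q : Fin k → ℕ) : (wordLevel n q).card = ∏ i, n i ^ q i := by
  simp [wordLevel, card_wordsOfLength]

/-- Puts the letter `j` of the `i`-th alphabet in front of the `i`-th word. -/
def consLetter (i : Fin k) (j : Fin (n i)) (β : Words n) : Words n :=
  Function.update β i (FreeMonoid.of j * β i)

lemma length_consLetter (i : Fin k) (j : Fin (n i)) (β : Words n) :
    (fun l => (consLetter i j β l).length) =
      Function.update (fun l => (β l).length) i ((β i).length + 1) := by
  funext l
  rcases eq_or_ne l i with rfl | hl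
  · simp [consLetter, add_comm]
  · simp [consLetter, hl]

lemma exists_eq_consLetter {i : Fin k} {β : Words n} (h : (β i).length ≠ 0) :
    ∃ j γ, β = consLetter i j γ := by
  obtain ⟨j, α, hα⟩ : ∃ j α, β i = FreeMonoid.of j * α := by
    generalize β i = α at h
    induction α using FreeMonoid.casesOn with
    | one => simp at h
    | of_mul j α => exact ⟨j, α, rfl⟩
  exact ⟨j, Function.update β i α, by simp [consLetter, ← hα]⟩

/-- Every word tuple of the raised level arises from exactly one letter and one tuple of level `q`,
so each tuple of level `q` has `n i` successors, none of larger weight. -/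
lemma sum_wordLevel_succ_le (q : Fin k → ℕ) (i : Fin k) {g : Words n → ℝ} (hg : ∀ β, 0 ≤ g β)
    (hstep : ∀ j β, g (consLetter i j β) ≤ g β) :
    ∑ β ∈ wordLevel n (Function.update q i (q i + 1)), g β ≤
      n i * ∑ β ∈ wordLevel n q, g β := by
  classical
  calc ∑ β ∈ wordLevel n (Function.update q i (q i + 1)), g β
      ≤ ∑ β ∈ (Finset.univ ×ˢ wordLevel n q).image fun p => consLetter i p.1 p.2, g β := by
        refine Finset.sum_le_sum_of_subset_of_nonneg (fun β hβ => ?_) fun β _ _ => hg β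
        rw [mem_wordLevel] at hβ
        obtain ⟨j, γ, rfl⟩ := exists_eq_consLetter (i := i) (β := β) (by simp [hβ i])
        refine Finset.mem_image.2 ⟨(j, γ), Finset.mem_product.2 ⟨Finset.mem_univ _, ?_⟩, rfl⟩
        rw [mem_wordLevel]
        intro l
        have h1 := congrFun (length_consLetter i j γ) l
        simp only [hβ l] at h1
        rcases eq_or_ne l i with rfl | hl
        · simpa using h1.symm
        · simpa [hl] using h1.symm
    _ = ∑ j, ∑ β ∈ wordLevel n q, g (consLetter i j β) := by
        rw [Finset.sum_image, Finset.sum_product]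
        rintro ⟨j, β⟩ _ ⟨j', γ⟩ _ h
        have hi := congrFun h i
        simp only [consLetter, Function.update_self, of_mul_inj] at hi
        refine Prod.ext hi.1 (funext fun l => ?_)
        rcases eq_or_ne l i with rfl | hl
        · exact hi.2
        · simpa [consLetter, hl] using congrFun h l
    _ ≤ ∑ _j : Fin (n i), ∑ β ∈ wordLevel n q, g β :=
        Finset.sum_le_sum fun j _ => Finset.sum_le_sum fun β _ => hstep j β
    _ = n i * ∑ β ∈ wordLevel n q, g β := by simp

end WordSets

/-! ### Traces -/

section Trace

variable {H : Type*} [NormedAddCommGroup H] [InnerProductSpace ℂ H] [CompleteSpace H]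

/-- The hypothesis says that `A` has the quadratic form of the finite sum of rank-one operators `u_i
⊗ u_i*`. Parseval for each `u_i` in the basis chosen by `posTrace` evaluates the trace, and shows
that it is finite, so that `toReal` loses nothing. -/
lemma posTrace_toReal_eq_sum {ι : Type*} (s : Finset ι) (u : ι → H) {A : H →L[ℂ] H}
    (hA : ∀ x, RCLike.re ⟪x, A x⟫_ℂ = ∑ i ∈ s, ‖⟪u i, x⟫_ℂ‖ ^ 2) :
    (posTrace A).toReal = ∑ i ∈ s, ‖u i‖ ^ 2 := by
  obtain ⟨b, hb⟩ := (exists_hilbertBasis ℂ H).choose_spec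
  have h1 : ∀ x : H, HasSum (fun e : (exists_hilbertBasis ℂ H).choose =>
      ‖⟪x, (e : H)⟫_ℂ‖ ^ 2) (‖x‖ ^ 2) := by
    intro x
    have h2 := (b.hasSum_inner_mul_inner x x).mapL (RCLike.reCLM (K := ℂ))
    simp only [hb, RCLike.reCLM_apply, inner_self_eq_norm_sq] at h2
    simpa only [inner_mul_symm_re_eq_norm, norm_mul, norm_inner_symm, ← pow_two] using h2
  have h2 : HasSum (fun e : (exists_hilbertBasis ℂ H).choose => RCLike.re ⟪(e : H), A e⟫_ℂ)
      (∑ i ∈ s, ‖u i‖ ^ 2) := by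
    simp only [hA]
    exact hasSum_sum fun i _ => h1 (u i)
  have h0 : ∀ e : (exists_hilbertBasis ℂ H).choose, 0 ≤ RCLike.re ⟪(e : H), A e⟫_ℂ := fun e => by
    rw [hA]
    positivity
  rw [posTrace, ← ENNReal.ofReal_tsum_of_nonneg h0 h2.summable, h2.tsum_eq, ENNReal.toReal_ofReal]
  positivity

variable {k : ℕ} {n : Fin k → ℕ}

lemma fockVec_inner (β : Words n) (x : H) (f : FockTensor n H) :
    ⟪fockVec H β x, f⟫_ℂ = ⟪x, f β⟫_ℂ :=
  letI : DecidableEq (Words n) := Classical.decEq _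
  lp.inner_single_left β x f

lemma fockVec_apply_self (β : Words n) (x : H) : fockVec H β x β = x :=
  letI : DecidableEq (Words n) := Classical.decEq _
  lp.single_apply_self (E := fun _ : Words n => H) 2 β x

lemma fockVec_apply_of_ne {β γ : Words n} (h : γ ≠ β) (x : H) : fockVec H β x γ = 0 :=
  letI : DecidableEq (Words n) := Classical.decEq _
  lp.single_apply_ne (E := fun _ : Words n => H) 2 β x h

lemma norm_fockVec (β : Words n) (x : H) : ‖fockVec H β x‖ = ‖x‖ := by
  have h := inner_self_eq_norm_sq (𝕜 := ℂ) (fockVec H β x)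
  rw [fockVec_inner, fockVec_apply_self, inner_self_eq_norm_sq] at h
  exact ((sq_eq_sq₀ (norm_nonneg _) (norm_nonneg _)).1 h).symm

lemma levelProj_apply (q : Fin k → ℕ) (f : FockTensor n H) :
    levelProj H n q f = ∑ β ∈ wordLevel n q, fockVec H β (f β) := by
  classical
  refine Submodule.eq_starProjection_of_mem_of_inner_eq_zero ?_ ?_
  · refine Submodule.sum_mem _ fun β hβ => Submodule.le_topologicalClosure _
      (Submodule.subset_span ⟨β, f β, mem_wordLevel.1 hβ, rfl⟩)
  · have hle : levelSpace H n q ≤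
        (ℂ ∙ (f - ∑ β ∈ wordLevel n q, fockVec H β (f β)))ᗮ := by
      refine Submodule.topologicalClosure_minimal _ (Submodule.span_le.2 ?_)
        (Submodule.isClosed_orthogonal _)
      rintro _ ⟨β, x, hβ, rfl⟩
      rw [SetLike.mem_coe, Submodule.mem_orthogonal_singleton_iff_inner_left, fockVec_inner]
      have : (∑ γ ∈ wordLevel n q, fockVec H γ (f γ)) β = f β := by
        rw [lp.coeFn_sum, Finset.sum_apply, Finset.sum_eq_single β, fockVec_apply_self]
        · exact fun γ _ h => fockVec_apply_of_ne h.symm _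
        · exact fun h => absurd (mem_wordLevel.2 hβ) h
      rw [lp.coeFn_sub, Pi.sub_apply, this, sub_self, inner_zero_right]
    intro w hw
    exact Submodule.mem_orthogonal_singleton_iff_inner_right.1 (hle hw)

lemma re_inner_levelProj (q : Fin k → ℕ) (f : FockTensor n H) :
    RCLike.re ⟪f, levelProj H n q f⟫_ℂ = ∑ β ∈ wordLevel n q, ‖f β‖ ^ 2 := by
  rw [levelProj_apply, inner_sum, map_sum]
  refine Finset.sum_congr rfl fun β _ => ?_
  rw [← inner_conj_symm, fockVec_inner, RCLike.conj_re, inner_self_eq_norm_sq]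

lemma posTrace_levelProj (q : Fin k → ℕ) :
    (posTrace (levelProj ℂ n q)).toReal = ∏ i, (n i : ℝ) ^ q i := by
  rw [posTrace_toReal_eq_sum (wordLevel n q) fun β => fockVec ℂ β 1]
  · simp [norm_fockVec, card_wordLevel]
  · intro f
    rw [re_inner_levelProj]
    simp [fockVec_inner]

end Trace

/-! ### Products of the entries of a tuple in the polyball -/

section Polyball

variable {H : Type*} [NormedAddCommGroup H] [InnerProductSpace ℂ H] [CompleteSpace H]
  {k : ℕ} {n : Fin k → ℕ} {X : OpTuple n H}

lemma wordOp_of_mul {m : ℕ} (Y : Fin m → (H →L[ℂ] H)) (j : Fin m) (α : FreeMonoid (Fin m)) :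
    wordOp Y (FreeMonoid.of j * α) = Y j * wordOp Y α := by
  simp [wordOp]

lemma commute_wordOp {m : ℕ} {Y : Fin m → (H →L[ℂ] H)} {A : H →L[ℂ] H}
    (h : ∀ j, Commute A (Y j)) (α : FreeMonoid (Fin m)) : Commute A (wordOp Y α) := by
  induction α using FreeMonoid.inductionOn' with
  | one => simp [wordOp]
  | of_mul j α ih =>
    rw [wordOp_of_mul]
    exact (h j).mul_right ih

lemma wordsOp_one : wordsOp X 1 = 1 := prod_ofFn_eq_one fun i => by simp [wordOp]

lemma wordsOp_consLetter (hX : X ∈ regularPolyball H n) (i : Fin k) (j : Fin (n i))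
    (β : Words n) : wordsOp X (consLetter i j β) = X i j * wordsOp X β := by
  rw [wordsOp, wordsOp, ← prod_ofFn_update_mul fun l hl =>
    commute_wordOp (fun b => hX.1 i l hl.symm j b) (β l)]
  congr 2
  funext l
  rcases eq_or_ne l i with rfl | hl
  · simp [consLetter, wordOp_of_mul]
  · simp [consLetter, hl]

/-- The Berezin coefficients apply the adjoints in the order `1, …, k`, not reversed; commuting rows
make this the adjoint of `wordsOp`. -/
lemma star_wordsOp (hX : X ∈ regularPolyball H n) (β : Words n) :
    star (wordsOp X β) = wordsStarOp X β := by
  refine star_prod_ofFn fun s t hst => ?_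
  refine commute_wordOp (fun b => (commute_wordOp (fun a => ?_) _).symm) _
  exact hX.1 t s hst.symm b a

/-- Positivity of the defect map for the indicator `p` of `i` reads `∑_l X_{i,l} X_{i,l}* ≤ I`.
Hence each adjoint is a contraction, and so is each entry. -/
lemma norm_apply_le (hX : X ∈ regularPolyball H n) (i : Fin k) (j : Fin (n i)) (x : H) :
    ‖X i j x‖ ≤ ‖x‖ := by
  have h0 : 0 ≤ (1 - cpMap (X i)) (1 : H →L[ℂ] H) := by
    have h := hX.2 (Function.update 0 i 1) fun l => by
      rcases eq_or_ne l i with rfl | hl <;> simp [*]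
    have h2 : (fun l => (1 - cpMap (X l)) ^ (Function.update 0 i 1 : Fin k → ℕ) l) =
        Function.update (fun _ => 1) i (1 - cpMap (X i)) := by
      funext l
      rcases eq_or_ne l i with rfl | hl <;> simp [*]
    rwa [defectMap, h2, prod_ofFn_single] at h
  have hpos := (ContinuousLinearMap.nonneg_iff_isPositive _).1 h0
  have h1 : ∀ y, ‖star (X i j) y‖ ≤ 1 * ‖y‖ := by
    intro y
    have h2 := hpos.re_inner_nonneg_right y
    have h3 : (1 - cpMap (X i)) 1 y = y - ∑ l, X i l (star (X i l) y) := by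
      simp [cpMap]
    simp only [h3, inner_sub_right, inner_sum, map_sub, map_sum, inner_self_eq_norm_sq] at h2
    have h4 : ∀ l, RCLike.re ⟪y, X i l (star (X i l) y)⟫_ℂ = ‖star (X i l) y‖ ^ 2 := fun l => by
      rw [ContinuousLinearMap.star_eq_adjoint, ← ContinuousLinearMap.adjoint_inner_left,
        inner_self_eq_norm_sq]
    simp only [h4] at h2
    have h5 := Finset.single_le_sum (f := fun l => ‖star (X i l) y‖ ^ 2)
      (fun _ _ => sq_nonneg _) (Finset.mem_univ j)
    rw [one_mul]
    refine le_of_sq_le_sq ?_ (norm_nonneg y)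
    linarith
  have h6 := ContinuousLinearMap.opNorm_le_bound _ zero_le_one h1
  rw [norm_star] at h6
  exact (X i j).le_of_opNorm_le h6 x |>.trans_eq (one_mul _)

lemma subset_wordSpan {q : Fin k → ℕ} {β : Words n} (hβ : ∀ i, (β i).length ≤ q i) {h : H}
    (hh : h ∈ defectRange X) : wordsOp X β h ∈ wordSpan X q :=
  Submodule.subset_span ⟨β, h, hβ, hh, rfl⟩

lemma wordSpan_mono : Monotone (wordSpan X) := fun _ _ hpq =>
  Submodule.span_mono fun _ ⟨β, h, hβ, hh, hv⟩ => ⟨β, h, fun i => (hβ i).trans (hpq i), hh, hv⟩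

lemma finiteDimensional_wordSpan (hfin : HasFiniteRankDefect X) (q : Fin k → ℕ) :
    FiniteDimensional ℂ (wordSpan X q) := by
  have : FiniteDimensional ℂ (defectRange X) := hfin
  let S : Submodule ℂ H := (Fintype.piFinset fun i => Finset.range (q i + 1)).sup fun p =>
    (wordLevel n p).sup fun β => (defectRange X).map (wordsOp X β : H →ₗ[ℂ] H)
  have hS : FiniteDimensional ℂ S := inferInstance
  refine Submodule.finiteDimensional_of_le (S₂ := S) (Submodule.span_le.2 ?_)
  rintro _ ⟨β, h, hβ, hh, rfl⟩
  refine SetLike.le_def.1 (Finset.le_sup_of_le (b := fun i => (β i).length) ?_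
    (Finset.le_sup (f := fun β => (defectRange X).map (wordsOp X β : H →ₗ[ℂ] H))
      (mem_wordLevel.2 fun _ => rfl))) (Submodule.mem_map_of_mem hh)
  simpa [Fintype.mem_piFinset, Nat.lt_succ_iff] using hβ

lemma map_wordSpan_le (hX : X ∈ regularPolyball H n) (q : Fin k → ℕ) (i : Fin k) (j : Fin (n i)) :
    (wordSpan X q).map (X i j : H →ₗ[ℂ] H) ≤ wordSpan X (Function.update q i (q i + 1)) := by
  rw [wordSpan, Submodule.map_span_le]
  rintro _ ⟨β, h, hβ, hh, rfl⟩
  have : X i j (wordsOp X β h) = wordsOp X (consLetter i j β) h := by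
    rw [wordsOp_consLetter hX]
    rfl
  rw [ContinuousLinearMap.coe_coe, this]
  refine subset_wordSpan (fun l => ?_) hh
  rw [congrFun (length_consLetter i j β) l]
  rcases eq_or_ne l i with rfl | hl
  · simpa using hβ l
  · simpa [hl] using hβ l

lemma wordSpan_update_succ_le (hX : X ∈ regularPolyball H n) (q : Fin k → ℕ) (i : Fin k) :
    wordSpan X (Function.update q i (q i + 1)) ≤
      wordSpan X q ⊔ ⨆ j, (wordSpan X q).map (X i j : H →ₗ[ℂ] H) := by
  refine Submodule.span_le.2 ?_
  rintro _ ⟨β, h, hβ, hh, rfl⟩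
  by_cases h0 : (β i).length = 0
  · refine SetLike.le_def.1 le_sup_left (subset_wordSpan (fun l => ?_) hh)
    rcases eq_or_ne l i with rfl | hl
    · omega
    · simpa [hl] using hβ l
  · obtain ⟨j, γ, rfl⟩ := exists_eq_consLetter h0
    rw [wordsOp_consLetter hX]
    refine SetLike.le_def.1 (le_sup_of_le_right
      (le_iSup (fun j => (wordSpan X q).map (X i j : H →ₗ[ℂ] H)) j))
      (Submodule.mem_map_of_mem (f := (X i j : H →ₗ[ℂ] H)) (subset_wordSpan (fun l => ?_) hh))
    have h1 := congrFun (length_consLetter i j γ) l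
    have h2 := hβ l
    rw [h1] at h2
    rcases eq_or_ne l i with rfl | hl
    · simpa using h2
    · simpa [hl] using h2

lemma eulerRatio_antitone (hX : X ∈ regularPolyball H n) (hfin : HasFiniteRankDefect X) :
    Antitone (eulerRatio X) := by
  have hfd := finiteDimensional_wordSpan hfin
  refine antitone_of_update_succ_le fun q i => ?_
  let D : ℕ → ℝ := fun t => Module.finrank ℂ (wordSpan X (Function.update q i t))
  have hsucc : ∀ t, wordSpan X (Function.update q i (t + 1)) ≤
      wordSpan X (Function.update q i t) ⊔
        ⨆ j, (wordSpan X (Function.update q i t)).map (X i j : H →ₗ[ℂ] H) := fun t => by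
    simpa using wordSpan_update_succ_le hX (Function.update q i t) i
  -- The first increment has no predecessor; taking `A = ⊥` gives the crude bound by `n i` copies of
  -- the initial space.
  have h0 : D 1 - D 0 ≤ n i * D 0 := by
    have := finrank_add_le_of_map_le (fun j => (X i j : H →ₗ[ℂ] H)) (A := ⊥) bot_le (by simp)
      (hsucc 0)
    rw [finrank_bot, mul_zero, add_zero] at this
    have : D 1 ≤ D 0 + n i * D 0 := by simp only [D]; exact_mod_cast this
    linarith
  have hstep : ∀ t, D (t + 2) - D (t + 1) ≤ n i * (D (t + 1) - D t) := fun t => by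
    have := finrank_add_le_of_map_le (fun j => (X i j : H →ₗ[ℂ] H))
      (A := wordSpan X (Function.update q i t))
      (wordSpan_mono (Function.update_mono t.le_succ))
      (fun j => by simpa using map_wordSpan_le hX (Function.update q i t) i j) (hsucc (t + 1))
    have : D (t + 2) + n i * D t ≤ D (t + 1) + n i * D (t + 1) := by
      simp only [D]; exact_mod_cast this
    linarith
  have key := div_geomSum_succ_le h0 hstep (q i)
  simp only [D] at key
  rw [Function.update_eq_self] at key
  rw [eulerRatio, eulerRatio, ← Finset.mul_prod_erase _ _ (Finset.mem_univ i),
    ← Finset.mul_prod_erase _ _ (Finset.mem_univ i), ← div_div, ← div_div,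
    Function.update_self]
  have : ∏ x ∈ Finset.univ.erase i,
      ∑ s ∈ Finset.range (Function.update q i (q i + 1) x + 1), (n x : ℝ) ^ s =
      ∏ x ∈ Finset.univ.erase i, ∑ s ∈ Finset.range (q x + 1), (n x : ℝ) ^ s :=
    Finset.prod_congr rfl fun x hx => by rw [Function.update_of_ne (Finset.ne_of_mem_erase hx)]
  rw [this]
  exact div_le_div_of_nonneg_right key (by positivity)

/-! ### The trace of a Berezin level -/

/-- The vectors `Δ_X(I)^{1/2} v_l`, for an orthonormal basis `(v_l)` of the range of `Δ_X(I)`. -/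
def sqrtDefectVec (X : OpTuple n H) [FiniteDimensional ℂ (defectRange X)]
    (l : Fin (Module.finrank ℂ (defectRange X))) : H :=
  CFC.sqrt (defect X) (stdOrthonormalBasis ℂ (defectRange X) l : H)

/-- The Hilbert-Schmidt norm squared of `X_{1,β₁} ⋯ X_{k,β_k} Δ_X(I)^{1/2}`. -/
def wordWeight (X : OpTuple n H) [FiniteDimensional ℂ (defectRange X)] (β : Words n) : ℝ :=
  ∑ l, ‖wordsOp X β (sqrtDefectVec X l)‖ ^ 2

variable [FiniteDimensional ℂ (defectRange X)]

lemma wordWeight_nonneg (β : Words n) : 0 ≤ wordWeight X β :=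
  Finset.sum_nonneg fun _ _ => sq_nonneg _

lemma wordWeight_consLetter_le (hX : X ∈ regularPolyball H n) (i : Fin k) (j : Fin (n i))
    (β : Words n) : wordWeight X (consLetter i j β) ≤ wordWeight X β := by
  refine Finset.sum_le_sum fun l _ => ?_
  rw [wordsOp_consLetter hX]
  exact pow_le_pow_left₀ (norm_nonneg _) (norm_apply_le hX i j _) 2

lemma berezinCoeff_mem_defectRange (hX : X ∈ regularPolyball H n) (β : Words n) (h : H) :
    berezinCoeff X β h ∈ defectRange X := by
  have := berezinCoeff_mem hX β h
  rwa [defectSpace, (Submodule.closed_of_finiteDimensional _).submodule_topologicalClosure_eq]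
    at this

lemma sqrtDefectVec_mem (hX : X ∈ regularPolyball H n)
    (l : Fin (Module.finrank ℂ (defectRange X))) : sqrtDefectVec X l ∈ defectRange X := by
  have := berezinCoeff_mem_defectRange hX 1 (stdOrthonormalBasis ℂ (defectRange X) l : H)
  rwa [berezinCoeff, ← star_wordsOp hX, wordsOp_one, star_one] at this

lemma inner_wordsOp_sqrtDefectVec (hX : X ∈ regularPolyball H n) (β : Words n) (h : H)
    (l : Fin (Module.finrank ℂ (defectRange X))) :
    ⟪wordsOp X β (sqrtDefectVec X l), h⟫_ℂ =
      ⟪(stdOrthonormalBasis ℂ (defectRange X) l : H), berezinCoeff X β h⟫_ℂ := by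
  have hs : (CFC.sqrt (defect X)).IsPositive :=
    (ContinuousLinearMap.nonneg_iff_isPositive _).1 (CFC.sqrt_nonneg _)
  rw [berezinCoeff, ← hs.inner_left_eq_inner_right, ← star_wordsOp hX,
    ContinuousLinearMap.star_eq_adjoint, ContinuousLinearMap.adjoint_inner_right]
  rfl

/-- Parseval in the range of the defect, where the coefficient lies. This moves the square root and
the adjoints onto finitely many fixed vectors, so that both the trace and the dimension estimate can
be read off. -/
lemma norm_berezinCoeff_sq (hX : X ∈ regularPolyball H n) (β : Words n) (h : H) :
    ‖berezinCoeff X β h‖ ^ 2 = ∑ l, ‖⟪wordsOp X β (sqrtDefectVec X l), h⟫_ℂ‖ ^ 2 := by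
  have := (stdOrthonormalBasis ℂ (defectRange X)).sum_sq_norm_inner_right
    ⟨berezinCoeff X β h, berezinCoeff_mem_defectRange hX β h⟩
  simp only [inner_wordsOp_sqrtDefectVec hX]
  exact this.symm

lemma posTrace_berezinLevel (hX : X ∈ regularPolyball H n) (q : Fin k → ℕ) :
    (posTrace (berezinLevel hX q)).toReal = ∑ β ∈ wordLevel n q, wordWeight X β := by
  rw [posTrace_toReal_eq_sum (wordLevel n q ×ˢ Finset.univ)
    fun p => wordsOp X p.1 (sqrtDefectVec X p.2)]
  · exact Finset.sum_product _ _ _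
  · intro h
    rw [Finset.sum_product, berezinLevel, ContinuousLinearMap.comp_apply,
      ContinuousLinearMap.adjoint_inner_right, ContinuousLinearMap.comp_apply, re_inner_levelProj]
    refine Finset.sum_congr rfl fun β _ => ?_
    rw [← norm_berezinCoeff_sq hX]
    rfl

lemma levelRatio_antitone (hX : X ∈ regularPolyball H n) (hn : ∀ i, 2 ≤ n i) :
    Antitone fun q => (∑ β ∈ wordLevel n q, wordWeight X β) / ∏ i, (n i : ℝ) ^ q i := by
  have hpos : ∀ i, (0 : ℝ) < n i := fun i => by exact_mod_cast zero_lt_two.trans_le (hn i)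
  have hprod : ∀ q : Fin k → ℕ, 0 < ∏ i, (n i : ℝ) ^ q i := fun q =>
    Finset.prod_pos fun i _ => pow_pos (hpos i) _
  refine antitone_of_update_succ_le fun q i => ?_
  have h1 : ∏ l, (n l : ℝ) ^ Function.update q i (q i + 1) l = n i * ∏ l, (n l : ℝ) ^ q l := by
    rw [← Finset.mul_prod_erase _ _ (Finset.mem_univ i),
      ← Finset.mul_prod_erase _ (fun l => (n l : ℝ) ^ q l) (Finset.mem_univ i),
      Function.update_self, pow_succ', mul_assoc]
    congr 2
    exact Finset.prod_congr rfl fun l hl => by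
      rw [Function.update_of_ne (Finset.ne_of_mem_erase hl)]
  have h2 := sum_wordLevel_succ_le q i wordWeight_nonneg fun j β =>
    wordWeight_consLetter_le hX i j β
  rw [h1, div_le_div_iff₀ (mul_pos (hpos i) (hprod q)) (hprod q)]
  calc _ ≤ _ := mul_le_mul_of_nonneg_right h2 (hprod q).le
    _ = _ := by ring

lemma sum_wordWeight_le_finrank (hX : X ∈ regularPolyball H n) (q : Fin k → ℕ) :
    ∑ p ∈ Fintype.piFinset fun i => Finset.range (q i + 1), ∑ β ∈ wordLevel n p, wordWeight X β ≤
      Module.finrank ℂ (wordSpan X q) := by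
  classical
  have hfd := finiteDimensional_wordSpan (X := X) ‹_› q
  let u := stdOrthonormalBasis ℂ (wordSpan X q)
  have hdisj : Set.PairwiseDisjoint
      (↑(Fintype.piFinset fun i => Finset.range (q i + 1)) : Set (Fin k → ℕ)) (wordLevel n) := by
    intro p _ p' _ hp
    refine Finset.disjoint_left.2 fun β h h' => hp (funext fun i => ?_)
    rw [← mem_wordLevel.1 h i, mem_wordLevel.1 h' i]
  rw [← Finset.sum_biUnion hdisj]
  set S := (Fintype.piFinset fun i => Finset.range (q i + 1)).biUnion (wordLevel n)
  have hS : ∀ β ∈ S, ∀ i, (β i).length ≤ q i := by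
    intro β hβ i
    obtain ⟨p, hp, hβ⟩ := Finset.mem_biUnion.1 hβ
    rw [mem_wordLevel.1 hβ i]
    exact Nat.lt_succ_iff.1 (Finset.mem_range.1 (Fintype.mem_piFinset.1 hp i))
  -- For `β ∈ S` the vectors `wordsOp X β (sqrtDefectVec X l)` lie in `wordSpan X q`, so their norms
  -- can be computed in the basis `u` of that space alone.
  have hw : ∀ β ∈ S, wordWeight X β = ∑ a, ‖berezinCoeff X β (u a : H)‖ ^ 2 := by
    intro β hβ
    simp only [norm_berezinCoeff_sq hX]
    rw [Finset.sum_comm]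
    refine Finset.sum_congr rfl fun l _ => ?_
    exact (u.sum_sq_norm_inner_left
      ⟨_, subset_wordSpan (hS β hβ) (sqrtDefectVec_mem hX l)⟩).symm
  rw [Finset.sum_congr rfl hw, Finset.sum_comm]
  -- For each `a` the sum over `S` is part of the squared norm of the Berezin kernel at `u a`, hence
  -- at most 1.
  calc ∑ a, ∑ β ∈ S, ‖berezinCoeff X β (u a : H)‖ ^ 2 ≤ ∑ a, ‖(u a : H)‖ ^ 2 := by
        refine Finset.sum_le_sum fun a _ => ?_
        obtain ⟨h1, h2⟩ := tsum_berezinCoeff_le hX (u a : H)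
        exact (h1.sum_le_tsum S fun _ _ => sq_nonneg _).trans h2
    _ = Module.finrank ℂ (wordSpan X q) := by
        have : ∀ a, ‖(u a : H)‖ = 1 := fun a => u.orthonormal.1 a
        simp [this]

end Polyball

end NCPolyball

end

/-! ### Existence of the limits and the curvature inequalities -/

theorem corollary1p3 {H : Type*} [NormedAddCommGroup H] [InnerProductSpace ℂ H] [CompleteSpace H]
    {k : ℕ} (n : Fin k → ℕ) (hn : ∀ i, 2 ≤ n i)
    (T : NCPolyball.OpTuple n H) (hT : T ∈ NCPolyball.regularPolyball H n)
    (hfin : NCPolyball.HasFiniteRankDefect T) :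
    ∃ curv χ : ℝ, NCPolyball.IsCurvature hT curv ∧ NCPolyball.IsEulerChar T χ ∧
      0 ≤ curv ∧ curv ≤ χ ∧ χ ≤ (Module.finrank ℂ (NCPolyball.defectRange T) : ℝ) := by
  have : FiniteDimensional ℂ (NCPolyball.defectRange T) := hfin
  let b : (Fin k → ℕ) → ℝ := fun q =>
    (∑ β ∈ NCPolyball.wordLevel n q, NCPolyball.wordWeight T β) / ∏ i, (n i : ℝ) ^ q i
  have hprod : ∀ q : Fin k → ℕ, 0 < ∏ i, (n i : ℝ) ^ q i := fun q =>
    Finset.prod_pos fun i _ => pow_pos (by exact_mod_cast zero_lt_two.trans_le (hn i)) _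
  have hb0 : ∀ q, 0 ≤ b q := fun q =>
    div_nonneg (Finset.sum_nonneg fun _ _ => NCPolyball.wordWeight_nonneg _) (hprod q).le
  have hbdd : BddBelow (Set.range b) := ⟨0, by rintro _ ⟨q, rfl⟩; exact hb0 q⟩
  have he0 : ∀ q, 0 ≤ NCPolyball.eulerRatio T q := fun q => by
    rw [NCPolyball.eulerRatio]
    positivity
  have hebdd : BddBelow (Set.range (NCPolyball.eulerRatio T)) :=
    ⟨0, by rintro _ ⟨q, rfl⟩; exact he0 q⟩
  refine ⟨⨅ q, b q, ⨅ q, NCPolyball.eulerRatio T q, ?_, fun q hq hcof => ?_, le_ciInf hb0,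
    le_ciInf fun q => ?_, (ciInf_le hebdd 0).trans ?_⟩
  · refine (NCPolyball.tendsto_simplexAverage (NCPolyball.levelRatio_antitone hT hn) hb0).congr
      fun m => ?_
    simp only [NCPolyball.curvAverage, NCPolyball.posTrace_berezinLevel,
      NCPolyball.posTrace_levelProj]
    rfl
  · exact (tendsto_atTop_ciInf (NCPolyball.eulerRatio_antitone hT hfin) hebdd).comp
      (tendsto_atTop_atTop_of_monotone hq hcof)
  · have hpos : 0 < ∏ i, ∑ s ∈ Finset.range (q i + 1), (n i : ℝ) ^ s :=
      Finset.prod_pos fun i _ => by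
        rw [Finset.sum_range_succ']
        positivity
    -- Expanding the product of geometric sums turns the denominator into `∑_{p ≤ q} ∏ n_i^{p_i}`,
    -- to be compared with the level sums term by term, using `inf b ≤ b p`.
    rw [NCPolyball.eulerRatio, le_div_iff₀ hpos, Finset.prod_univ_sum, Finset.mul_sum]
    refine (Finset.sum_le_sum fun p _ => ?_).trans (NCPolyball.sum_wordWeight_le_finrank hT q)
    exact (le_div_iff₀ (hprod p)).1 (ciInf_le hbdd p)
  -- At `q = 0` only the empty words remain, and the denominator is 1.
  · have hle : NCPolyball.wordSpan T 0 ≤ NCPolyball.defectRange T := by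
      refine Submodule.span_le.2 ?_
      rintro _ ⟨β, h, hβ, hh, rfl⟩
      have : β = 1 := funext fun i => FreeMonoid.length_eq_zero.1 (Nat.le_zero.1 (hβ i))
      rwa [this, NCPolyball.wordsOp_one]
    simpa [NCPolyball.eulerRatio] using Submodule.finrank_mono hle
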